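/- Let $T=\{0,1\}^*$ be the rooted tree of finite binary words, in which each word $w$ is joined to $w0$ and $w1$, and let $G\le\mathrm{Aut}(T)$ be the Grigorchuk group, i.e. the subgroup generated by the automorphisms $a,b,c,d$ defined recursively by $$a(0w)=1w,\quad a(1w)=0w,\qquad b(0w)=0a(w),\quad b(1w)=1c(w),$$ $$c(0w)=0a(w),\quad c(1w)=1d(w),\qquad d(0w)=0w,\quad d(1w)=1b(w)$$ (all four fix the empty word). Let $\Gamma_n$ be the Schreier graph of the action of $G$ on $\{0,1\}^n$ with respect to $\{a,b,c,d\}$ (vertex set $\{0,1\}^n$, edges $(x,sx)$ for $s\in\{a,b,c,d\}$), and let $d_n$ be its graph distance. For a group $H$ with a finite symmetric generating set $S$ and an $H$-set $X$, let $\Gamma(H,X)$ denote the Schreier graph of the action, $d$ its graph distance, and $\mathrm{vol}_{H,X}(n)=\max_{x\in X}|B_H(n)\cdot x|$, where $B_H(n)$ is the ball of radius $n$ around the identity for the word metric of $S$. The action has orbits of controlled diameter if all $H$-orbits in $X$ are finite and there is $C>0$ such that for every non-trivial $h\in H$ there are an $H$-orbit $O\subset X$ and $x\in O$ with $hx\ne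 x$ and $\mathrm{diam}(\Gamma(H,O))\le C\,d(x,hx)$. For $f\colon\mathbb N\to\mathbb N$, let $\mathcal C_{\mathrm{CD}}(f)$ be the class of finitely generated groups $H$ that admit an action on a set $X$ with orbits of controlled diameter and such that, for some integer $C>0$, $\mathrm{vol}_{H,X}(n)\le C f(Cn)$ for all $n\ge1$ (these conditions do not depend on the choice of $S$). Write $\mathcal C_{\mathrm{CD}}(\mathrm{lin})$ for the case $f(n)=n$. Then for every non-trivial $g\in G$ there exist $n\ge 1$ and $w\in\{0,1\}^n$ such that $$d_n(gw,w)\ \ge\ \tfrac18\,\mathrm{diam}(\Gamma_n).$$ In particular, $G$ belongs to $\mathcal C_{\mathrm{CD}}(\mathrm{lin})$. -/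

import Mathlib

universe u

/-! ### Schreier graphs, growth of actions, and the class `C_CD(f)` -/

section Actions

variable {G : Type u} [Group G]

/-- The Schreier graph of an action of `G` on `X` with respect to `S ⊆ G`: the points `x` and
`s • x` are joined for all `s ∈ S`. Loops and multiplicities of edges are discarded, as they do
not influence distances. -/
def schreierGraph (S : Set G) (X : Type*) [MulAction G X] : SimpleGraph X :=
  SimpleGraph.fromRel fun x y => ∃ s ∈ S, s • x = y

/-- The ball of radius `n` around `1` for the word metric of the symmetric generating set `S`. -/
def wordBall (S : Set G) (n : ℕ) : Set G :=
  {g | ∃ l : List G, l.length ≤ n ∧ (∀ s ∈ l, s ∈ S) ∧ l.prod = g}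

/-- The growth of the action of `G` on `X`: the largest cardinality of `B_G(n) • x`. -/
noncomputable def actionGrowth (S : Set G) (X : Type*) [MulAction G X] (n : ℕ) : ℕ∞ :=
  ⨆ x : X, ((fun g : G => g • x) '' wordBall S n).encard

/-- The relation `f₁ ≼ f₂`: there is `C > 0` with `f₁ n ≤ C f₂ (C n)` for all `n ≥ 1`. -/
def GrowthLE (f₁ f₂ : ℕ → ℕ∞) : Prop :=
  ∃ C : ℕ, 0 < C ∧ ∀ n : ℕ, 1 ≤ n → f₁ n ≤ C * f₂ (C * n)

/-- The action of `G` on `X` has orbits of controlled diameter (with respect to `S`): all orbits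
are finite, and there is `C > 0` such that each non-trivial `g` moves some point `x` with
`diam (Γ(G, O)) ≤ C d(x, g x)`, where `O` is the orbit of `x`. -/
def HasOrbitsOfControlledDiameter (S : Set G) (X : Type*) [MulAction G X] : Prop :=
  (∀ x : X, (MulAction.orbit G x).Finite) ∧
    ∃ C : ℝ, 0 < C ∧ ∀ g : G, g ≠ 1 → ∃ x : X, g • x ≠ x ∧
      ((schreierGraph S (MulAction.orbit G x)).diam : ℝ) ≤
        C * ((schreierGraph S X).dist x (g • x) : ℝ)

end Actions

/-- The class `C_CD(f)`: the finitely generated groups that admit an action with orbits of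
controlled diameter and with growth `≼ f`, for some finite symmetric generating set (neither
property depends on the generating set). -/
def InClassCD (f : ℕ → ℕ) (G : Type u) [Group G] : Prop :=
  ∃ S : Set G, S.Finite ∧ (∀ s ∈ S, s⁻¹ ∈ S) ∧ Subgroup.closure S = ⊤ ∧
    ∃ (X : Type u) (_ : MulAction G X),
      HasOrbitsOfControlledDiameter S X ∧
        GrowthLE (actionGrowth S X) (fun n => (f n : ℕ∞))

/-! ### The binary tree and its automorphism group -/

/-- In the rooted binary tree, `v` is a child of `u` if `v = ux` for a letter `x`.
The letters `0`, `1` are `false`, `true`. -/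
def IsChild (u v : List Bool) : Prop := ∃ x : Bool, v = u ++ [x]

/-- The automorphism group of the rooted tree of finite binary words. -/
def treeAut : Subgroup (Equiv.Perm (List Bool)) where
  carrier := {g | g [] = [] ∧ ∀ u v, IsChild (g u) (g v) ↔ IsChild u v}
  one_mem' := ⟨rfl, fun _ _ => Iff.rfl⟩
  mul_mem' := by
    rintro g h ⟨hg, hg'⟩ ⟨hh, hh'⟩
    refine ⟨by simp [hh, hg], fun u v => ?_⟩
    rw [Equiv.Perm.mul_apply, Equiv.Perm.mul_apply, hg', hh']
  inv_mem' := by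
    rintro g ⟨hg, hg'⟩
    refine ⟨by rw [Equiv.Perm.inv_eq_iff_eq, hg], fun u v => ?_⟩
    rw [← hg' (g⁻¹ u) (g⁻¹ v)]
    simp

theorem treeAut_length (g : treeAut) (w : List Bool) :
    ((g : Equiv.Perm (List Bool)) w).length = w.length := by
  induction w using List.reverseRecOn with
  | nil => rw [g.2.1]
  | append_singleton u x ih =>
    obtain ⟨y, hy⟩ := (g.2.2 u (u ++ [x])).2 ⟨x, rfl⟩
    rw [hy, List.length_append, List.length_append, ih]
    rfl

/-- The `n`-th level `{0, 1}ⁿ` of the binary tree. -/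
def Level (n : ℕ) : Type := {w : List Bool // w.length = n}

/-- The action of the automorphism group of the tree on the `n`-th level. -/
instance Level.instMulAction (n : ℕ) : MulAction treeAut (Level n) where
  smul g w := ⟨(g : Equiv.Perm (List Bool)) w.1, (treeAut_length g w.1).trans w.2⟩
  one_smul _ := rfl
  mul_smul _ _ _ := rfl

/-! ### The Grigorchuk group -/

/-- `a(0w) = 1w`, `a(1w) = 0w`. -/
def grigAFun : List Bool → List Bool
  | [] => []
  | x :: w => (!x) :: w

mutual

/-- `b(0w) = 0a(w)`, `b(1w) = 1c(w)`. -/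
def grigBFun : List Bool → List Bool
  | [] => []
  | false :: w => false :: grigAFun w
  | true :: w => true :: grigCFun w

/-- `c(0w) = 0a(w)`, `c(1w) = 1d(w)`. -/
def grigCFun : List Bool → List Bool
  | [] => []
  | false :: w => false :: grigAFun w
  | true :: w => true :: grigDFun w

/-- `d(0w) = 0w`, `d(1w) = 1b(w)`. -/
def grigDFun : List Bool → List Bool
  | [] => []
  | false :: w => false :: w
  | true :: w => true :: grigBFun w

end

theorem grigAFun_involutive : Function.Involutive grigAFun := by
  intro w
  cases w <;> simp [grigAFun]

theorem grigBCDFun_involutive (w : List Bool) :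
    grigBFun (grigBFun w) = w ∧ grigCFun (grigCFun w) = w ∧ grigDFun (grigDFun w) = w := by
  induction w with
  | nil => simp [grigBFun, grigCFun, grigDFun]
  | cons x w ih =>
    cases x <;> simp [grigBFun, grigCFun, grigDFun, grigAFun_involutive w, ih]

theorem grigAFun_isChild (u : List Bool) (x : Bool) :
    IsChild (grigAFun u) (grigAFun (u ++ [x])) := by
  cases u with
  | nil => exact ⟨!x, rfl⟩
  | cons y u => exact ⟨x, rfl⟩

theorem IsChild.cons {u v : List Bool} (h : IsChild u v) (y : Bool) :
    IsChild (y :: u) (y :: v) := by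
  obtain ⟨x, rfl⟩ := h
  exact ⟨x, rfl⟩

theorem grigBCDFun_isChild (u : List Bool) (x : Bool) :
    IsChild (grigBFun u) (grigBFun (u ++ [x])) ∧
    IsChild (grigCFun u) (grigCFun (u ++ [x])) ∧
    IsChild (grigDFun u) (grigDFun (u ++ [x])) := by
  induction u with
  | nil =>
    cases x <;> simp [grigBFun, grigCFun, grigDFun, grigAFun, IsChild]
  | cons y u ih =>
    cases y
    · simp only [List.cons_append, grigBFun, grigCFun, grigDFun]
      exact ⟨(grigAFun_isChild u x).cons _, (grigAFun_isChild u x).cons _,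
        IsChild.cons ⟨x, rfl⟩ _⟩
    · simp only [List.cons_append, grigBFun, grigCFun, grigDFun]
      exact ⟨ih.2.1.cons _, ih.2.2.cons _, ih.1.cons _⟩

/-- An involution of the set of words that fixes the root and maps children to children is an
automorphism of the tree. -/
def treeAutOfInvolutive (f : List Bool → List Bool) (hf : Function.Involutive f)
    (h0 : f [] = []) (hc : ∀ u x, IsChild (f u) (f (u ++ [x]))) : treeAut :=
  ⟨hf.toPerm f, h0, fun u v => by
    have key : ∀ u v, IsChild u v → IsChild (f u) (f v) := by
      rintro u _ ⟨x, rfl⟩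
      exact hc u x
    refine ⟨fun h => ?_, key u v⟩
    have h2 := key _ _ h
    simpa only [Function.Involutive.coe_toPerm, hf u, hf v] using h2⟩

/-- The generator `a`. -/
def grigA : treeAut :=
  treeAutOfInvolutive grigAFun grigAFun_involutive rfl grigAFun_isChild

/-- The generator `b`. -/
def grigB : treeAut :=
  treeAutOfInvolutive grigBFun (fun w => (grigBCDFun_involutive w).1) (by simp [grigBFun])
    (fun u x => (grigBCDFun_isChild u x).1)

/-- The generator `c`. -/
def grigC : treeAut :=
  treeAutOfInvolutive grigCFun (fun w => (grigBCDFun_involutive w).2.1) (by simp [grigCFun])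
    (fun u x => (grigBCDFun_isChild u x).2.1)

/-- The generator `d`. -/
def grigD : treeAut :=
  treeAutOfInvolutive grigDFun (fun w => (grigBCDFun_involutive w).2.2) (by simp [grigDFun])
    (fun u x => (grigBCDFun_isChild u x).2.2)

/-- The Grigorchuk group, generated by `a, b, c, d` in the automorphism group of the tree. -/
def grigorchukGroup : Subgroup treeAut :=
  Subgroup.closure {grigA, grigB, grigC, grigD}

/-- The generating set `{a, b, c, d}`, as a subset of the Grigorchuk group. -/
def grigorchukGenerators : Set grigorchukGroup :=
  {s | (s : treeAut) ∈ ({grigA, grigB, grigC, grigD} : Set treeAut)}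

/-- The Schreier graph `Γ_n` of the action of the Grigorchuk group on the level `{0, 1}ⁿ`. -/
def grigorchukSchreierGraph (n : ℕ) : SimpleGraph (Level n) :=
  schreierGraph grigorchukGenerators (Level n)

-- Potentials on Schreier graphs

section Actions

variable {G : Type u} [Group G] {S : Set G} {X : Type*} [MulAction G X]

-- The Gray code `grayPos` numbers each level from 0 to `2 ^ n - 1`, and generators change the
-- number by at most one. So differences of numbers bound distances from below, while `2 ^ n - 1`
-- bounds the diameter from above. Let `v` be a shortest vertex at which `g` is active. Then `g`
-- fixes `v` and exchanges `v0` and `v1`, whose numbers are symmetric about the middle of the level.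
-- They are far apart unless `v` has its number in the last eighth of its level, i.e. `v = w110`. In
-- that case the section of `g` at `w` lies in the group and fixes all words of length at most 3. By
-- `activityParity_relation` it is active at an even number of vertices of level 3, so `110` can be
-- replaced by another suffix. For the class `C_CD(lin)`, the group acts on the disjoint union of
-- all levels. A ball of radius `n` changes numbers by at most `n`, and numbers are injective on
-- each level, so growth is linear.

theorem SimpleGraph.diam_lt_card {V : Type*} [Fintype V] [Nonempty V] (H : SimpleGraph V) :
    H.diam < Fintype.card V := by
  by_cases hc : H.Connected
  · obtain ⟨u, v, huv⟩ := H.exists_dist_eq_diam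
    obtain ⟨p, hp, hl⟩ := (hc u v).exists_path_of_dist
    rw [← huv, ← hl]
    exact hp.length_lt
  · rw [SimpleGraph.diam_eq_zero_of_not_connected hc]
    exact Fintype.card_pos

theorem schreierGraph_reachable_smul {s : G} (hs : s ∈ S) (x : X) :
    (schreierGraph S X).Reachable x (s • x) := by
  by_cases h : x = s • x
  · rw [← h]
  · exact SimpleGraph.Adj.reachable ((SimpleGraph.fromRel_adj _ _ _).2 ⟨h, Or.inl ⟨s, hs, rfl⟩⟩)

theorem schreierGraph_reachable_smul_of_mem_closure {g : G} (hg : g ∈ Subgroup.closure S) (x : X) :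
    (schreierGraph S X).Reachable x (g • x) := by
  induction hg using Subgroup.closure_induction generalizing x with
  | mem s hs => exact schreierGraph_reachable_smul hs x
  | one => rw [one_smul]
  | mul g h _ _ ihg ihh => rw [mul_smul]; exact (ihh x).trans (ihg _)
  | inv g _ ih => simpa using (ih (g⁻¹ • x)).symm

/-- A function changing by at most one under each element of `S`. -/
def IsLipschitzPotential (S : Set G) (F : X → ℕ) : Prop :=
  ∀ s ∈ S, ∀ x, F (s • x) ≤ F x + 1 ∧ F x ≤ F (s • x) + 1

theorem IsLipschitzPotential.le_add_dist {F : X → ℕ} (hF : IsLipschitzPotential S F) {x y : X}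
    (h : (schreierGraph S X).Reachable x y) : F y ≤ F x + (schreierGraph S X).dist x y := by
  obtain ⟨p, hp⟩ := h.exists_walk_length_eq_dist
  rw [← hp]
  clear hp h
  induction p with
  | nil => simp
  | @cons x y z hadj p ih =>
    rw [SimpleGraph.Walk.length_cons]
    obtain ⟨s, hs, rfl⟩ | ⟨s, hs, rfl⟩ := ((SimpleGraph.fromRel_adj _ _ _).1 hadj).2
    · have := (hF s hs x).1
      omega
    · have := (hF s hs y).2
      omega

theorem IsLipschitzPotential.of_mem_wordBall {F : X → ℕ} (hF : IsLipschitzPotential S F) {n : ℕ}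
    {g : G} (hg : g ∈ wordBall S n) (x : X) : F (g • x) ≤ F x + n ∧ F x ≤ F (g • x) + n := by
  obtain ⟨l, hl, hS, rfl⟩ := hg
  suffices h : F (l.prod • x) ≤ F x + l.length ∧ F x ≤ F (l.prod • x) + l.length by omega
  clear hl
  induction l with
  | nil => simp
  | cons s l ih =>
    have h1 := ih fun t ht => hS t (List.mem_cons_of_mem _ ht)
    have h2 := hF s (hS s List.mem_cons_self) (l.prod • x)
    rw [List.prod_cons, mul_smul, List.length_cons]
    omega

/-- An action with a Lipschitz potential that is injective on orbits has linear growth. -/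
theorem IsLipschitzPotential.actionGrowth_le {F : X → ℕ} (hF : IsLipschitzPotential S F)
    (hinj : ∀ (x : X) (g h : G), F (g • x) = F (h • x) → g • x = h • x) (n : ℕ) :
    actionGrowth S X n ≤ (2 * n + 1 : ℕ) := by
  refine iSup_le fun x => ?_
  have hI : Set.InjOn F ((fun g : G => g • x) '' wordBall S n) := by
    rintro _ ⟨g, -, rfl⟩ _ ⟨h, -, rfl⟩ hgh
    exact hinj x g h hgh
  rw [← hI.encard_image]
  have hsub : F '' ((fun g : G => g • x) '' wordBall S n) ⊆
      (Finset.Icc (F x - n) (F x + n) : Finset ℕ) := by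
    rintro _ ⟨_, ⟨g, hg, rfl⟩, rfl⟩
    have := hF.of_mem_wordBall hg x
    rw [Finset.mem_coe, Finset.mem_Icc]
    dsimp only
    omega
  refine (Set.encard_le_encard hsub).trans ?_
  rw [Set.encard_coe_eq_coe_finsetCard, Nat.card_Icc]
  exact_mod_cast (by omega)

end Actions

/-! ### Positions on the Schreier graphs of the Grigorchuk group -/

/-- The distance of a word from the end `1ⁿ` of the Schreier graph on its level, which is a
segment. -/
def grayPos : List Bool → ℕ
  | [] => 0
  | x :: w => 2 * grayPos w + (grayPos w + (!x).toNat) % 2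

theorem grayPos_lt (w : List Bool) : grayPos w < 2 ^ w.length := by
  induction w with
  | nil => simp [grayPos]
  | cons x w ih => simp only [grayPos, List.length_cons, pow_succ]; omega

theorem grayPos_inj {v w : List Bool} (hl : v.length = w.length) (h : grayPos v = grayPos w) :
    v = w := by
  induction v generalizing w with
  | nil => exact (List.length_eq_zero_iff.1 hl.symm).symm
  | cons x v ih =>
    cases w with
    | nil => simp at hl
    | cons y w =>
      simp only [grayPos] at h
      have hvw : v = w := ih (by simpa using hl) (by omega)
      subst hvw
      cases x <;> cases y <;> simp at h ⊢ <;> omega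

theorem grayPos_append_true (w : List Bool) : grayPos (w ++ [true]) = grayPos w := by
  induction w with
  | nil => simp [grayPos]
  | cons x w ih => simp only [List.cons_append, grayPos, ih]

/-- A final letter `0` reflects the segment. In the induction the two positions add up to an odd
number, so the low-order bits added by a new first letter are complementary. -/
theorem grayPos_append_false (w : List Bool) :
    grayPos (w ++ [false]) + grayPos w + 1 = 2 ^ (w.length + 1) := by
  induction w with
  | nil => simp [grayPos]
  | cons x w ih =>
    simp only [List.cons_append, grayPos, List.length_cons, pow_succ] at ih ⊢
    omega

/-- Each prefixed letter doubles the position and adds at most one, so the suffix determines the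
leading bits. -/
theorem grayPos_append_lt (v w : List Bool) :
    grayPos (v ++ w) < 2 ^ v.length * (grayPos w + 1) := by
  induction v with
  | nil => simp
  | cons x v ih =>
    simp only [List.cons_append, grayPos, List.length_cons, pow_succ]
    rw [mul_right_comm]
    omega

theorem grayPos_grigAFun (w : List Bool) : grayPos (grigAFun w) / 2 = grayPos w / 2 ∧
    (w ≠ [] → (grayPos (grigAFun w) + grayPos w) % 2 = 1) := by
  cases w with
  | nil => simp [grigAFun]
  | cons x w =>
    simp only [grigAFun, grayPos]
    obtain ⟨k, hk | hk⟩ := Nat.even_or_odd' (grayPos w) <;> cases x <;>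
      simp only [hk, Bool.not_false, Bool.not_true, Bool.toNat_true, Bool.toNat_false, ne_eq] <;>
      omega

/-- `p` and `q` are equal or are `2k + 1` and `2k + 2` in some order. -/
def OddStep (p q : ℕ) : Prop :=
  q = p ∨ (p % 2 = 1 ∧ q = p + 1) ∨ (q % 2 = 1 ∧ p = q + 1)

/-- The parity makes the induction work: prefixing `1` sends `p`, `p + 1` with `p` odd to `2p + 1`,
`2p + 2`, and prefixing `0` sends the `a`-edge `2k`, `2k + 1` to `4k + 1`, `4k + 2`. -/
theorem oddStep_grayPos_grigBCDFun (w : List Bool) :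
    OddStep (grayPos w) (grayPos (grigBFun w)) ∧ OddStep (grayPos w) (grayPos (grigCFun w)) ∧
      OddStep (grayPos w) (grayPos (grigDFun w)) := by
  unfold OddStep
  induction w with
  | nil => simp [grigBFun, grigCFun, grigDFun]
  | cons x w ih =>
    have ha := grayPos_grigAFun w
    cases x
    · by_cases hw : w = []
      · subst hw
        simp [grigBFun, grigCFun, grigDFun, grigAFun]
      · replace ha := And.intro ha.1 (ha.2 hw)
        simp only [grigBFun, grigCFun, grigDFun, grayPos, Bool.not_false, Bool.toNat_true]
        obtain ⟨k, hk | hk⟩ := Nat.even_or_odd' (grayPos w)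
        · have : grayPos (grigAFun w) = 2 * k + 1 := by omega
          simp only [hk, this, true_or, and_true]
          omega
        · have : grayPos (grigAFun w) = 2 * k := by omega
          simp only [hk, this, true_or, and_true]
          omega
    · simp only [grigBFun, grigCFun, grigDFun, grayPos, Bool.not_true, Bool.toNat_false]
      omega

theorem grigA_apply (w : List Bool) : (grigA : Equiv.Perm (List Bool)) w = grigAFun w := rfl
theorem grigB_apply (w : List Bool) : (grigB : Equiv.Perm (List Bool)) w = grigBFun w := rfl
theorem grigC_apply (w : List Bool) : (grigC : Equiv.Perm (List Bool)) w = grigCFun w := rfl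
theorem grigD_apply (w : List Bool) : (grigD : Equiv.Perm (List Bool)) w = grigDFun w := rfl

theorem grayPos_generator {s : treeAut} (hs : s ∈ ({grigA, grigB, grigC, grigD} : Set treeAut))
    (w : List Bool) :
    grayPos ((s : Equiv.Perm (List Bool)) w) ≤ grayPos w + 1 ∧
      grayPos w ≤ grayPos ((s : Equiv.Perm (List Bool)) w) + 1 := by
  have ha := (grayPos_grigAFun w).1
  have h := oddStep_grayPos_grigBCDFun w
  unfold OddStep at h
  rcases hs with rfl | rfl | rfl | rfl
  · rw [grigA_apply]; omega
  · rw [grigB_apply]; omega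
  · rw [grigC_apply]; omega
  · rw [grigD_apply]; omega

/-! ### Activity of tree automorphisms -/

/-- Whether the automorphism `g` exchanges the last letters of the children of `v`. -/
def flips (g : treeAut) (v : List Bool) : Bool :=
  ((g : Equiv.Perm (List Bool)) (v ++ [false])).getLast?.getD false

theorem treeAut_append_singleton (g : treeAut) (v : List Bool) (x : Bool) :
    (g : Equiv.Perm (List Bool)) (v ++ [x]) =
      (g : Equiv.Perm (List Bool)) v ++ [xor x (flips g v)] := by
  obtain ⟨y, hy⟩ := (g.2.2 v (v ++ [false])).2 ⟨false, rfl⟩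
  have hf : flips g v = y := by simp [flips, hy]
  cases x
  · simp [hy, hf]
  · obtain ⟨z, hz⟩ := (g.2.2 v (v ++ [true])).2 ⟨true, rfl⟩
    have hne : z ≠ y := by
      rintro rfl
      simpa using (g : Equiv.Perm (List Bool)).injective (hy.trans hz.symm)
    rw [hz, hf]
    cases y <;> cases z <;> simp at hne ⊢

theorem flips_mul (g h : treeAut) (v : List Bool) :
    flips (g * h) v = xor (flips h v) (flips g ((h : Equiv.Perm (List Bool)) v)) := by
  have h1 := treeAut_append_singleton (g * h) v false
  rw [Subgroup.coe_mul, Equiv.Perm.mul_apply, Equiv.Perm.mul_apply, treeAut_append_singleton h,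
    treeAut_append_singleton g] at h1
  simpa using h1.symm

instance (k : ℕ) : Fintype (Level k) := inferInstanceAs (Fintype (List.Vector Bool k))

theorem card_level (k : ℕ) : Fintype.card (Level k) = 2 ^ k := by
  exact card_vector (α := Bool) k

/-- The number of vertices of level `k` at which `g` is active, modulo two. -/
def activityParity (k : ℕ) (g : treeAut) : ZMod 2 :=
  ∑ v : Level k, ((flips g v.1).toNat : ZMod 2)

/-- The activity of `g` is evaluated at `h v`; since `h` permutes the level, reindexing removes it.
-/
theorem activityParity_mul (k : ℕ) (g h : treeAut) :
    activityParity k (g * h) = activityParity k g + activityParity k h := by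
  have hx : ∀ x y : Bool, ((xor x y).toNat : ZMod 2) = x.toNat + y.toNat := by decide
  unfold activityParity
  simp only [flips_mul, hx, Finset.sum_add_distrib]
  rw [add_comm]
  congr 1
  exact Equiv.sum_comp (MulAction.toPerm h : Equiv.Perm (Level k))
    fun v => ((flips g v.1).toNat : ZMod 2)

theorem generator_mul_self {s : treeAut} (hs : s ∈ ({grigA, grigB, grigC, grigD} : Set treeAut)) :
    s * s = 1 := by
  refine Subtype.ext (Equiv.ext fun w => ?_)
  rw [Subgroup.coe_mul, Equiv.Perm.mul_apply]
  rcases hs with rfl | rfl | rfl | rfl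
  · exact grigAFun_involutive w
  · exact (grigBCDFun_involutive w).1
  · exact (grigBCDFun_involutive w).2.1
  · exact (grigBCDFun_involutive w).2.2

theorem generator_inv {s : treeAut} (hs : s ∈ ({grigA, grigB, grigC, grigD} : Set treeAut)) :
    s⁻¹ = s :=
  inv_eq_of_mul_eq_one_left (generator_mul_self hs)

@[elab_as_elim]
theorem grigorchukGroup_induction {p : treeAut → Prop} (one : p 1)
    (mul : ∀ s ∈ ({grigA, grigB, grigC, grigD} : Set treeAut), ∀ g, p g → p (s * g))
    {g : treeAut} (hg : g ∈ grigorchukGroup) : p g := by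
  induction hg using Subgroup.closure_induction_left with
  | one => exact one
  | mul_left s hs g _ ih => exact mul s hs g ih
  | inv_mul_cancel s hs g _ ih => rw [generator_inv hs]; exact mul s hs g ih

/-- By additivity it suffices to check generators. On levels 1, 2, 3 the parities are (0,0,0) for
`a`, (1,1,0) for `b`, (1,0,1) for `c` and (0,1,1) for `d`. -/
theorem activityParity_relation {g : treeAut} (hg : g ∈ grigorchukGroup) :
    activityParity 1 g + activityParity 2 g + activityParity 3 g = 0 := by
  refine grigorchukGroup_induction (by decide +kernel) (fun s hs g ih => ?_) hg
  have hgen : activityParity 1 s + activityParity 2 s + activityParity 3 s = 0 := by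
    rcases hs with rfl | rfl | rfl | rfl <;> decide +kernel
  simp only [activityParity_mul]
  linear_combination ih + hgen

theorem exists_section_cons {g : treeAut} (hg : g ∈ grigorchukGroup) (x : Bool) :
    ∃ h ∈ grigorchukGroup, ∃ y, ∀ u,
      (g : Equiv.Perm (List Bool)) (x :: u) = y :: (h : Equiv.Perm (List Bool)) u := by
  have mem : ∀ s ∈ ({grigA, grigB, grigC, grigD} : Set treeAut), s ∈ grigorchukGroup :=
    fun s hs => Subgroup.subset_closure hs
  have hA := mem grigA (by simp)
  have hB := mem grigB (by simp)
  have hC := mem grigC (by simp)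
  have hD := mem grigD (by simp)
  refine grigorchukGroup_induction ⟨1, one_mem _, x, fun u => rfl⟩ (fun s hs g ih => ?_) hg
  obtain ⟨h, hh, y, hy⟩ := ih
  suffices H : ∃ t ∈ grigorchukGroup, ∃ z, ∀ u,
      (s : Equiv.Perm (List Bool)) (y :: u) = z :: (t : Equiv.Perm (List Bool)) u by
    obtain ⟨t, ht, z, hz⟩ := H
    refine ⟨t * h, mul_mem ht hh, z, fun u => ?_⟩
    rw [Subgroup.coe_mul, Equiv.Perm.mul_apply, hy, hz]
    rfl
  rcases hs with rfl | rfl | rfl | rfl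
  · exact ⟨1, one_mem _, !y, fun u => rfl⟩
  · cases y
    · exact ⟨grigA, hA, false, fun u => by simp [grigB_apply, grigA_apply, grigBFun]⟩
    · exact ⟨grigC, hC, true, fun u => by simp [grigB_apply, grigC_apply, grigBFun]⟩
  · cases y
    · exact ⟨grigA, hA, false, fun u => by simp [grigC_apply, grigA_apply, grigCFun]⟩
    · exact ⟨grigD, hD, true, fun u => by simp [grigC_apply, grigD_apply, grigCFun]⟩
  · cases y
    · exact ⟨1, one_mem _, false, fun u => by simp [grigD_apply, grigDFun]⟩
    · exact ⟨grigB, hB, true, fun u => by simp [grigD_apply, grigB_apply, grigDFun]⟩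

/-- The Grigorchuk group is self-similar: the sections of its elements lie in it. -/
theorem exists_section {g : treeAut} (hg : g ∈ grigorchukGroup) (w : List Bool) :
    ∃ h ∈ grigorchukGroup, ∀ u, (g : Equiv.Perm (List Bool)) (w ++ u) =
      (g : Equiv.Perm (List Bool)) w ++ (h : Equiv.Perm (List Bool)) u := by
  induction w generalizing g with
  | nil => exact ⟨g, hg, fun u => by rw [g.2.1]; rfl⟩
  | cons x w ih =>
    obtain ⟨h, hh, y, hy⟩ := exists_section_cons hg x
    obtain ⟨k, hk, hk'⟩ := ih hh
    exact ⟨k, hk, fun u => by rw [List.cons_append, hy, hy, hk', List.cons_append]⟩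

/-! ### Elements acting trivially on a level -/

theorem flips_of_fixed {g : treeAut} {v : List Bool} {x : Bool}
    (h : (g : Equiv.Perm (List Bool)) (v ++ [x]) = v ++ [x]) : flips g v = false := by
  rw [treeAut_append_singleton] at h
  have := (List.append_inj' h rfl).2
  cases x <;> simpa using this

theorem activityParity_eq_zero {g : treeAut} {k : ℕ}
    (h : ∀ v : List Bool, v.length = k + 1 → (g : Equiv.Perm (List Bool)) v = v) :
    activityParity k g = 0 := by
  refine Finset.sum_eq_zero fun v _ => ?_
  rw [flips_of_fixed (x := false) (h _ (by rw [List.length_append, v.2]; rfl))]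
  simp

/-- An element of the Grigorchuk group fixing the third level is not active at exactly one vertex of
that level. -/
theorem exists_flips_ne {g : treeAut} (hg : g ∈ grigorchukGroup)
    (hfix : ∀ v : List Bool, v.length ≤ 3 → (g : Equiv.Perm (List Bool)) v = v)
    {v : List Bool} (hv : v.length = 3) (hgv : flips g v = true) :
    ∃ v' : List Bool, v'.length = 3 ∧ v' ≠ v ∧ flips g v' = true := by
  by_contra! hcon
  have h := activityParity_relation hg
  have h3 : activityParity 3 g = ((flips g v).toNat : ZMod 2) := by
    refine Finset.sum_eq_single (⟨v, hv⟩ : Level 3) (fun u _ hu => ?_)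
      fun h => (h (Finset.mem_univ (α := Level 3) _)).elim
    have := hcon u.1 u.2 fun h => hu (Subtype.ext h)
    simp [this]
  rw [activityParity_eq_zero fun u hu => hfix u (by omega),
    activityParity_eq_zero fun u hu => hfix u (by omega), h3, hgv] at h
  simp at h

/-- The vertex is the parent of a shortest moved word: being fixed itself, it must be active. -/
theorem exists_minimal_moved {g : treeAut} (hg : g ≠ 1) :
    ∃ v : List Bool, flips g v = true ∧
      ∀ u : List Bool, u.length ≤ v.length → (g : Equiv.Perm (List Bool)) u = u := by
  have hex : ∃ n, ∃ w : List Bool, w.length = n ∧ (g : Equiv.Perm (List Bool)) w ≠ w := by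
    by_contra! hcon
    exact hg (Subtype.ext (Equiv.ext fun w => hcon _ w rfl))
  classical
  obtain ⟨w, hw, hgw⟩ := Nat.find_spec hex
  have hmin : ∀ u : List Bool, u.length < w.length → (g : Equiv.Perm (List Bool)) u = u := by
    intro u hu
    by_contra hgu
    exact Nat.find_min hex (hw ▸ hu) ⟨u, rfl, hgu⟩
  rcases List.eq_nil_or_concat w with rfl | ⟨v, x, rfl⟩
  · exact absurd g.2.1 hgw
  · rw [List.concat_eq_append] at *
    refine ⟨v, ?_, fun u hu => hmin u (by simp; omega)⟩
    by_contra hf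
    apply hgw
    rw [treeAut_append_singleton, hmin v (by simp), Bool.eq_false_of_not_eq_true hf, Bool.xor_false]

/-- A non-trivial element of the Grigorchuk group is active at a vertex, on the first possible
level, which is not too far from the end `1ⁿ` of the Schreier graph. -/
theorem exists_flips_grayPos_le {g : treeAut} (hg : g ∈ grigorchukGroup) (hg1 : g ≠ 1) :
    ∃ v : List Bool, flips g v = true ∧ (g : Equiv.Perm (List Bool)) v = v ∧
      16 * grayPos v + 7 ≤ 14 * 2 ^ v.length := by
  obtain ⟨v, hv, hfix⟩ := exists_minimal_moved hg1
  by_cases hlen : v.length < 3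
  -- On levels 0, 1, 2 the trivial bound `2 ^ k - 1` on positions is already enough.
  · refine ⟨v, hv, hfix v le_rfl, ?_⟩
    have := grayPos_lt v
    interval_cases v.length <;> omega
  obtain ⟨w, s, rfl, hs⟩ : ∃ w s : List Bool, v = w ++ s ∧ s.length = 3 :=
    ⟨v.take (v.length - 3), v.drop (v.length - 3), (List.take_append_drop _ _).symm, by
      rw [List.length_drop]; omega⟩
  rw [List.length_append, hs] at hfix
  have key : ∀ t : List Bool, t.length = 3 → grayPos t ≠ 7 → flips g (w ++ t) = true →
      ∃ v : List Bool, flips g v = true ∧ (g : Equiv.Perm (List Bool)) v = v ∧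
        16 * grayPos v + 7 ≤ 14 * 2 ^ v.length := by
    intro t ht ht7 hgt
    refine ⟨w ++ t, hgt, hfix _ (by simp [ht]), ?_⟩
    have h1 := grayPos_append_lt w t
    have h2 := grayPos_lt t
    rw [ht] at h2
    have h3 : 2 ^ w.length * (grayPos t + 1) ≤ 2 ^ w.length * 7 :=
      Nat.mul_le_mul_left _ (by omega)
    rw [List.length_append, ht, pow_add]
    omega
  -- Position 7, the far end of level 3, is the only bad suffix; parity in the section at `w`
  -- supplies another one.
  by_cases hs7 : grayPos s = 7
  · obtain ⟨h, hh, hsec⟩ := exists_section hg w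
    have hgw : (g : Equiv.Perm (List Bool)) w = w := hfix w (by omega)
    have hflip : ∀ u, flips g (w ++ u) = flips h u := by
      intro u
      have h1 := treeAut_append_singleton g (w ++ u) false
      rw [List.append_assoc, hsec, hsec, List.append_assoc, List.append_cancel_left_eq,
        treeAut_append_singleton] at h1
      simpa using h1.symm
    have hhfix : ∀ u : List Bool, u.length ≤ 3 → (h : Equiv.Perm (List Bool)) u = u := by
      intro u hu
      have h1 := hfix (w ++ u) (by rw [List.length_append]; omega)
      rwa [hsec, hgw, List.append_cancel_left_eq] at h1
    obtain ⟨t, ht, hts, hft⟩ := exists_flips_ne hh hhfix hs ((hflip s).symm.trans hv)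
    exact key t ht (fun h7 => hts (grayPos_inj (ht.trans hs.symm) (h7.trans hs7.symm)))
      ((hflip t).trans hft)
  · exact key s hs hs7 hv

/-- The move from `v1` to `v0` has displacement `2 ^ n - 1 - 2 * grayPos v` with `n = v.length + 1`.
The bound on `grayPos v` says exactly that this is at least `(2 ^ n - 1) / 8`. -/
theorem exists_large_displacement {g : grigorchukGroup} (hg : g ≠ 1) :
    ∃ n : ℕ, 1 ≤ n ∧ ∃ w : Level n, 8 * grayPos w.1 + 2 ^ n ≤ 8 * grayPos (g • w).1 + 1 := by
  obtain ⟨v, hv, hgv, hpos⟩ := exists_flips_grayPos_le g.2 fun h => hg (Subtype.ext h)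
  let w : Level (v.length + 1) := ⟨v ++ [true], by simp⟩
  refine ⟨v.length + 1, by omega, w, ?_⟩
  have hsmul : (g • w).1 = v ++ [false] := by
    refine (treeAut_append_singleton g.1 v true).trans ?_
    rw [hv, hgv]
    rfl
  rw [hsmul]
  have h1 := grayPos_append_true v
  have h2 := grayPos_append_false v
  rw [pow_succ] at h2 ⊢
  change 8 * grayPos (v ++ [true]) + _ ≤ _
  omega

/-! ### The main theorem -/

theorem closure_grigorchukGenerators : Subgroup.closure grigorchukGenerators = ⊤ :=
  Subgroup.closure_closure_coe_preimage

theorem isLipschitzPotential_level (n : ℕ) :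
    IsLipschitzPotential grigorchukGenerators fun w : Level n => grayPos w.1 :=
  fun _ hs w => grayPos_generator hs w.1

theorem isLipschitzPotential_sigma :
    IsLipschitzPotential grigorchukGenerators fun w : Σ n, Level n => grayPos w.2.1 :=
  fun _ hs w => grayPos_generator hs w.2.1

instance (n : ℕ) : Nonempty (Level n) := ⟨⟨List.replicate n true, by simp⟩⟩

theorem orbit_sigma_subset (x : Σ n, Level n) :
    MulAction.orbit grigorchukGroup x ⊆ Set.range (Sigma.mk x.1 : Level x.1 → Σ n, Level n) := by
  rintro _ ⟨g, rfl⟩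
  exact ⟨g • x.2, rfl⟩

theorem orbit_sigma_finite (x : Σ n, Level n) : (MulAction.orbit grigorchukGroup x).Finite :=
  (Set.finite_range _).subset (orbit_sigma_subset x)

theorem diam_orbit_sigma_lt (x : Σ n, Level n) :
    (schreierGraph grigorchukGenerators (MulAction.orbit grigorchukGroup x)).diam < 2 ^ x.1 := by
  have := (orbit_sigma_finite x).fintype
  have : Nonempty (MulAction.orbit grigorchukGroup x) := ⟨⟨x, MulAction.mem_orbit_self x⟩⟩
  refine (SimpleGraph.diam_lt_card _).trans_le ?_
  rw [← card_level, ← Nat.card_eq_fintype_card, ← Nat.card_eq_fintype_card (α := Level x.1)]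
  refine (Nat.card_mono (Set.finite_range _) (orbit_sigma_subset x)).trans ?_
  exact Finite.card_range_le _

theorem hasOrbitsOfControlledDiameter_sigma :
    HasOrbitsOfControlledDiameter grigorchukGenerators (Σ n, Level n) := by
  refine ⟨orbit_sigma_finite, 8, by norm_num, fun g hg => ?_⟩
  obtain ⟨n, hn, w, hw⟩ := exists_large_displacement hg
  let x : Σ n, Level n := ⟨n, w⟩
  -- This makes the displacement positive, so that the point is really moved.
  have hn2 : 2 ≤ 2 ^ n := Nat.pow_le_pow_right (by norm_num : 0 < 2) hn
  have hdiam := diam_orbit_sigma_lt x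
  have hdist := isLipschitzPotential_sigma.le_add_dist
    (schreierGraph_reachable_smul_of_mem_closure
      (closure_grigorchukGenerators ▸ Subgroup.mem_top g) x)
  change grayPos (g • w).1 ≤ grayPos w.1 + _ at hdist
  change _ < 2 ^ n at hdiam
  refine ⟨x, fun h => ?_, ?_⟩
  · rw [h, SimpleGraph.dist_self] at hdist
    omega
  · exact_mod_cast (by omega)

theorem sigma_smul_inj (x : Σ n, Level n) (g h : grigorchukGroup)
    (hgh : grayPos (g • x).2.1 = grayPos (h • x).2.1) : g • x = h • x :=
  Sigma.ext rfl (heq_of_eq (Subtype.ext (grayPos_inj ((g • x.2).2.trans (h • x.2).2.symm) hgh)))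

theorem grigorchukGroup_inClassCD : InClassCD (fun n => n) grigorchukGroup := by
  refine ⟨grigorchukGenerators, ?_, fun s hs => ?_, closure_grigorchukGenerators,
    Σ n, Level n, inferInstance, hasOrbitsOfControlledDiameter_sigma, 2, by norm_num,
    fun n hn => (isLipschitzPotential_sigma.actionGrowth_le sigma_smul_inj n).trans ?_⟩
  · exact (Set.toFinite ({grigA, grigB, grigC, grigD} : Set treeAut)).preimage
      Subtype.val_injective.injOn
  · change (s : treeAut)⁻¹ ∈ ({grigA, grigB, grigC, grigD} : Set treeAut)
    rw [generator_inv hs]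
    exact hs
  -- This needs `1 ≤ n`.
  · have : 2 * n + 1 ≤ 2 * (2 * n) := by omega
    change ((2 * n + 1 : ℕ) : ℕ∞) ≤ (2 : ℕ) * ((2 * n : ℕ) : ℕ∞)
    exact_mod_cast this

theorem mainTheorem6 :
    (∀ g : grigorchukGroup, g ≠ 1 → ∃ n : ℕ, 1 ≤ n ∧ ∃ w : Level n,
      ((grigorchukSchreierGraph n).diam : ℝ) / 8 ≤
        ((grigorchukSchreierGraph n).dist (g • w) w : ℝ)) ∧
    InClassCD (fun n => n) grigorchukGroup := by
  refine ⟨fun g hg => ?_, grigorchukGroup_inClassCD⟩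
  obtain ⟨n, hn, w, hw⟩ := exists_large_displacement hg
  refine ⟨n, hn, w, ?_⟩
  have hdiam := (grigorchukSchreierGraph n).diam_lt_card
  rw [card_level] at hdiam
  have hdist := (isLipschitzPotential_level n).le_add_dist
    (schreierGraph_reachable_smul_of_mem_closure
      (closure_grigorchukGenerators ▸ Subgroup.mem_top g) w)
  rw [SimpleGraph.dist_comm] at hdist
  change _ ≤ _ + (grigorchukSchreierGraph n).dist (g • w) w at hdist
  rw [div_le_iff₀ (by norm_num)]
  exact_mod_cast (by omega)
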